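/- For a word $w=w_1\cdots w_m$ of distinct positive integers, let $\operatorname{run}(w)$ be the number of its alternating runs, i.e. of its maximal segments of at least two consecutive letters that are increasing or decreasing. A Stirling permutation of order $n$ is an arrangement of the multiset $\{1,1,2,2,\ldots,n,n\}$ in which, for each $i$, all letters between the two occurrences of $i$ are larger than $i$; let $\mathcal Q_n$ be the set of these. Let $\Phi$ replace, for each $j$, the first occurrence of $j$ in $\sigma\in\mathcal Q_n$ by $2j$ and the second one by $2j-1$; the elements of $\Phi(\mathcal Q_n)$ are the dual Stirling permutations of order $n$. Let $$F_n(x)=\sum_{\pi\in\Phi(\mathcal Q_n)}x^{\operatorname{run}(\pi)}$$ be the alternating run polynomial of the dual Stirling permutations of order $n$ (so $F_0(x)=1$, $F_1(x)=x$). Let $\mathcal B_n$ be the set of signed permutations $\sigma=\sigma(1)\cdots\sigma(n)$, i.e. of words of integers whose absolute values are an arrangement of $1,\ldots,n$, and let $$B_n(x)=\sum_{\sigma\in\mathcal B_n}x^{\operatorname{des}_B(\sigma)},\qquad \operatorname{des}_B(\sigma)=\#\{0\le i\le n-1:\ \sigma(i)>\sigma(i+1)\},\quad \sigma(0)=0,$$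 be the type $B$ Eulerian polynomial (so $B_0(x)=1$). (i) With $r(x)=\sqrt{\frac{1+x}{1-x}}$, for all $n\ge 0$ and $-1<x<1$, $$\left(x\frac{\mathrm d}{\mathrm dx}\right)^{n}r(x)=\frac{r(x)F_n(x)}{(1-x^2)^n}.$$ (ii) For every $n\ge 1$, $F_{n+1}(x)=\det\bigl(h_{ij}(x)\bigr)_{0\le i,j\le n}$, where the lower Hessenberg matrix $(h_{ij})$ of order $n+1$ is given by $$h_{i,0}(x)=x\,B_i(x^2),\qquad h_{ij}(x)=-\binom{i}{j-1}F_{i-j+1}(-x)\ \ (1\le j\le i+1),\qquad h_{ij}(x)=0\ \ (j>i+1).$$ -/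

import Mathlib

namespace DualStirling

open Polynomial

/-- The positions `i, i + 1, …, j` of the word `w` form a segment with at least two letters that is
either increasing or decreasing. -/
def IsMonotoneSegment (w : List ℕ) (i j : ℕ) : Prop :=
  i < j ∧ j < w.length ∧
    ((∀ k, i ≤ k → k < j → w.getD k 0 < w.getD (k + 1) 0) ∨
      (∀ k, i ≤ k → k < j → w.getD (k + 1) 0 < w.getD k 0))

/-- The positions `i, i + 1, …, j` form an alternating run of `w`: a monotone segment that is not
contained in a longer one. -/
def IsAlternatingRun (w : List ℕ) (i j : ℕ) : Prop :=
  IsMonotoneSegment w i j ∧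
    ∀ i' j', i' ≤ i → j ≤ j' → IsMonotoneSegment w i' j' → i' = i ∧ j' = j

open Classical in
/-- The number of alternating runs of `w`. -/
noncomputable def run (w : List ℕ) : ℕ :=
  ((Finset.range w.length ×ˢ Finset.range w.length).filter
    fun p => IsAlternatingRun w p.1 p.2).card

/-- Whenever `a … b … a` occurs as a subsequence of `w`, the middle letter `b` is larger than `a`. -/
def IsStirling (w : List ℕ) : Prop :=
  ∀ a b : ℕ, List.Sublist [a, b, a] w → a < b

open Classical in
/-- The Stirling permutations of order `n`: the arrangements `w` of the multiset `{1,1,2,2,…,n,n}`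
in which all letters between the two occurrences of a letter `a` are larger than `a`. -/
noncomputable def stirlingPermutations (n : ℕ) : Finset (List ℕ) :=
  (2 • (Finset.Icc 1 n).val).lists.toFinset.filter IsStirling

/-- The map `Φ`, which replaces the first occurrence of each letter `a` by `2 * a` and the second
occurrence by `2 * a - 1`. -/
def dualMap (w : List ℕ) : List ℕ :=
  w.mapIdx fun i a => if a ∈ w.take i then 2 * a - 1 else 2 * a

/-- The dual Stirling permutations of order `n`. -/
noncomputable def dualStirlingPermutations (n : ℕ) : Finset (List ℕ) :=
  (stirlingPermutations n).image dualMap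

/-- `F n`, the alternating run polynomial of the dual Stirling permutations of order `n`. -/
noncomputable def F (n : ℕ) : ℤ[X] :=
  ∑ w ∈ dualStirlingPermutations n, X ^ run w

/-- The word `w = σ(1) σ(2) ⋯ σ(n)` over the integers is a signed permutation of order `n`: the
absolute values of its letters are an arrangement of `1, 2, …, n`. -/
def IsSignedPermutation (n : ℕ) (w : List ℤ) : Prop :=
  ((w.map Int.natAbs : List ℕ) : Multiset ℕ) = (Finset.Icc 1 n).val

theorem finite_isSignedPermutation (n : ℕ) : {w : List ℤ | IsSignedPermutation n w}.Finite := by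
  have h : {w : List ℤ | w.length = n ∧ ∀ x ∈ w, x ∈ Set.Icc (-n : ℤ) n}.Finite := by
    have := List.finite_length_eq (Set.Icc (-n : ℤ) n) n
    refine (this.image (List.map Subtype.val)).subset ?_
    rintro w ⟨h1, h2⟩
    exact ⟨w.attach.map fun x => ⟨x.1, h2 x.1 x.2⟩, by simpa using h1, by simp⟩
  refine h.subset ?_
  intro w hw
  have hw' : ((w.map Int.natAbs : List ℕ) : Multiset ℕ) = (Finset.Icc 1 n).val := hw
  refine ⟨by simpa using congrArg Multiset.card hw', ?_⟩
  intro x hx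
  have h1 : x.natAbs ∈ ((w.map Int.natAbs : List ℕ) : Multiset ℕ) :=
    Multiset.mem_coe.2 (List.mem_map_of_mem hx)
  rw [hw', Finset.mem_val, Finset.mem_Icc] at h1
  rw [Set.mem_Icc]
  omega

/-- The hyperoctahedral group of rank `n`, as the set of signed permutations `σ(1) σ(2) ⋯ σ(n)`. -/
noncomputable def signedPermutations (n : ℕ) : Finset (List ℤ) :=
  (finite_isSignedPermutation n).toFinset

/-- The number of `i ∈ {0, 1, …, n - 1}` with `σ(i) > σ(i + 1)`, where `σ(0) = 0`. -/
def desB (w : List ℤ) : ℕ :=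
  ((Finset.range w.length).filter
    fun i => ((0 : ℤ) :: w).getD (i + 1) 0 < ((0 : ℤ) :: w).getD i 0).card

/-- `B n`, the type `B` Eulerian polynomial. -/
noncomputable def B (n : ℕ) : ℤ[X] :=
  ∑ w ∈ signedPermutations n, X ^ desB w

/-- The lower Hessenberg matrix of order `n + 1`, with rows and columns numbered `0, 1, …, n`:
column `0` has entries `x * B_i(x^2)`, column `j ≥ 1` has entries
`- binom(i, j - 1) * F_{i - j + 1}(-x)` for `j ≤ i + 1`, and `0` for `j > i + 1`. -/
noncomputable def hessenberg (n : ℕ) : Matrix (Fin (n + 1)) (Fin (n + 1)) ℤ[X] :=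
  Matrix.of fun i j =>
    if (j : ℕ) = 0 then X * (B (i : ℕ)).comp (X ^ 2)
    else if (j : ℕ) ≤ (i : ℕ) + 1 then
      -(((i : ℕ).choose ((j : ℕ) - 1) : ℕ) : ℤ[X]) * (F ((i : ℕ) + 1 - (j : ℕ))).comp (-X)
    else 0

/-- The differential operator `x d/dx` on functions of a real variable. -/
noncomputable def xDeriv (f : ℝ → ℝ) : ℝ → ℝ := fun x => x * deriv f x

/-- `r(x) = √((1 + x) / (1 - x))`. -/
noncomputable def r (x : ℝ) : ℝ := √((1 + x) / (1 - x))

end DualStirling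

namespace DualStirling

open Polynomial

/-! ### Sums over words with a block inserted -/

/-! Everything rests on two recurrences obtained by inserting the largest letter(s). Inserting
±(n+1) into a signed permutation gives `B_succ`; inserting the adjacent pair 2(n+1), 2n+1 into a
dual Stirling permutation gives `F_succ`. Write D = x d/dx. Since D r = x r/(1-x²), `F_succ` says
exactly that one more D sends rF_n/(1-x²)^n to rF_{n+1}/(1-x²)^(n+1), which is (i). For (ii),
r(x)r(-x) = 1 gives r(-x)·Dr(x) = x/(1-x²). Applying D^n by Leibniz suggests `sum_choose_mul_F`: ∑
C(n,k) F_{n-k}(-x) F_{k+1}(x) = xB_n(x²), which is proved purely algebraically from the recurrences.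
For n = 0, 1, 2, … this is a unitriangular linear system for F_1, F_2, …; Cramer's rule and a cyclic
shift of columns yield the Hessenberg determinant. -/

theorem append_cons_inj_of_notMem {α : Type*} {u u' z z' : List α} {c c' : α}
    (h : u ++ c :: z = u' ++ c' :: z') (hc : c ∉ u') (hc' : c' ∉ u) :
    u = u' ∧ c = c' ∧ z = z' := by
  rcases List.append_eq_append_iff.1 h with ⟨a, rfl, h2⟩ | ⟨a, rfl, h2⟩
  · cases a with
    | nil => simpa using h2
    | cons d a =>
      obtain ⟨rfl, -⟩ := List.cons.inj h2
      simp at hc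
  · cases a with
    | nil =>
      obtain ⟨rfl, rfl⟩ := List.cons.inj h2
      simp
    | cons d a =>
      obtain ⟨rfl, -⟩ := List.cons.inj h2
      simp at hc'

/-- If `T` consists of the words obtained from words of `S` by inserting a block `c :: t` whose
first letter `c ∈ C` is new, then a sum over `T` is a sum over all insertions. -/
theorem sum_insertions {α M : Type*} [AddCommMonoid M] {S T : Finset (List α)}
    {C : Finset α} {t : List α}
    (hT : ∀ w, w ∈ T ↔ ∃ c ∈ C, ∃ u v, u ++ v ∈ S ∧ w = u ++ c :: (t ++ v))
    (hC : ∀ w ∈ S, ∀ c ∈ C, c ∉ w) (f : List α → M) :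
    ∑ w ∈ T, f w = ∑ w ∈ S, ∑ i ∈ Finset.range (w.length + 1), ∑ c ∈ C,
      f (w.take i ++ c :: (t ++ w.drop i)) := by
  have key : ∀ w ∈ S, ∑ i ∈ Finset.range (w.length + 1), ∑ c ∈ C,
      f (w.take i ++ c :: (t ++ w.drop i)) =
      ∑ p ∈ Finset.range (w.length + 1) ×ˢ C,
        f (w.take p.1 ++ p.2 :: (t ++ w.drop p.1)) := fun w _ =>
    (Finset.sum_product _ _ fun p : ℕ × α => f (w.take p.1 ++ p.2 :: (t ++ w.drop p.1))).symm
  rw [Finset.sum_congr rfl key, Finset.sum_sigma']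
  symm
  refine Finset.sum_nbij
    (fun p => p.1.take p.2.1 ++ p.2.2 :: (t ++ p.1.drop p.2.1)) ?_ ?_ ?_ ?_
  · rintro ⟨w, i, c⟩ h
    simp only [Finset.mem_sigma, Finset.mem_product] at h
    exact (hT _).2 ⟨c, h.2.2, w.take i, w.drop i, by simpa using h.1, rfl⟩
  · rintro ⟨w, i, c⟩ h ⟨w', i', c'⟩ h' heq
    simp only [Finset.coe_sigma, Set.mem_sigma_iff, Finset.mem_coe, Finset.mem_product,
      Finset.mem_range] at h h'
    -- The new letter marks the place of insertion, so the word inserted into can be recovered.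
    obtain ⟨h1, rfl, h3⟩ := append_cons_inj_of_notMem heq
      (fun hm => hC _ h'.1 _ h.2.2 (List.mem_of_mem_take hm))
      (fun hm => hC _ h.1 _ h'.2.2 (List.mem_of_mem_take hm))
    have h3 := List.append_cancel_left h3
    have hw : w = w' := by
      rw [← List.take_append_drop i w, ← List.take_append_drop i' w', h1, h3]
    subst hw
    have h4 := congrArg List.length h1
    simp only [List.length_take] at h4
    have : i = i' := by omega
    subst this
    rfl
  · rintro w hw
    obtain ⟨c, hc, u, v, huv, rfl⟩ := (hT _).1 hw
    refine ⟨⟨u ++ v, u.length, c⟩, ?_, by simp⟩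
    simp [huv, hc]
  · intros
    rfl

theorem Icc_one_succ_val (n : ℕ) :
    (Finset.Icc 1 (n + 1)).val = (n + 1) ::ₘ (Finset.Icc 1 n).val := by
  have h : Finset.Icc 1 (n + 1) = Finset.cons (n + 1) (Finset.Icc 1 n) (by simp) := by
    ext x
    simp
    omega
  rw [h, Finset.cons_val]

/-! ### The recurrence for the type `B` Eulerian polynomials -/

/-- The number of descents of the word `a :: w`. -/
def descents (a : ℤ) : List ℤ → ℕ
  | [] => 0
  | b :: w => (if b < a then 1 else 0) + descents b w

theorem card_descents (a : ℤ) (w : List ℤ) :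
    ((Finset.range w.length).filter
      fun i => (a :: w).getD (i + 1) 0 < (a :: w).getD i 0).card = descents a w := by
  induction w generalizing a with
  | nil => simp [descents]
  | cons b w ih =>
    rw [descents, ← ih b, Finset.card_filter, Finset.card_filter, List.length_cons,
      Finset.sum_range_succ', add_comm]
    simp

theorem desB_eq_descents (w : List ℤ) : desB w = descents 0 w := card_descents 0 w

/-- Between two letters, either sign of N leaves one ascent and one descent: a descent gap keeps the
count, an ascent gap raises it by one. At the end, N keeps the count and -N raises it. -/
theorem sum_descents_insert (N : ℤ) (w : List ℤ) (hw : ∀ x ∈ w, -N < x ∧ x < N)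
    (a : ℤ) (ha : -N < a ∧ a < N) :
    ∑ i ∈ Finset.range (w.length + 1),
      ((X : ℤ[X]) ^ descents a (w.take i ++ N :: w.drop i) +
        X ^ descents a (w.take i ++ (-N) :: w.drop i)) =
      (2 * ((descents a w : ℕ) : ℤ[X]) + 1) * X ^ descents a w +
        (2 * ((w.length : ℤ[X]) - ((descents a w : ℕ) : ℤ[X])) + 1) * X ^ (descents a w + 1) := by
  induction w generalizing a with
  | nil => simp [descents, ha.1, ha.2.le]
  | cons b w ih =>
    have hb := hw b (by simp)
    rw [List.length_cons, Finset.sum_range_succ']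
    simp only [List.take_succ_cons, List.drop_succ_cons, List.cons_append, List.take_zero,
      List.drop_zero, List.nil_append, descents]
    simp only [pow_add, ← mul_add, ← Finset.mul_sum]
    rw [ih (fun x hx => hw x (List.mem_cons_of_mem _ hx)) b hb]
    simp only [ha.1, hb.2, not_lt.2 ha.2.le, not_lt.2 hb.1.le, if_true, if_false]
    split_ifs <;> push_cast <;> ring

theorem mem_signedPermutations {n : ℕ} {w : List ℤ} :
    w ∈ signedPermutations n ↔ IsSignedPermutation n w := by
  simp [signedPermutations]

theorem IsSignedPermutation.length_eq {n : ℕ} {w : List ℤ} (h : IsSignedPermutation n w) :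
    w.length = n := by
  simpa using congrArg Multiset.card h

theorem IsSignedPermutation.natAbs_le {n : ℕ} {w : List ℤ} (h : IsSignedPermutation n w)
    {x : ℤ} (hx : x ∈ w) : x.natAbs ≤ n := by
  have h1 : x.natAbs ∈ ((w.map Int.natAbs : List ℕ) : Multiset ℕ) :=
    Multiset.mem_coe.2 (List.mem_map_of_mem hx)
  rw [show ((w.map Int.natAbs : List ℕ) : Multiset ℕ) = _ from h, Finset.mem_val,
    Finset.mem_Icc] at h1
  exact h1.2

theorem isSignedPermutation_insert {n : ℕ} {u v : List ℤ} {c : ℤ} (hc : c.natAbs = n + 1) :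
    IsSignedPermutation (n + 1) (u ++ c :: v) ↔ IsSignedPermutation n (u ++ v) := by
  have h : (((u ++ c :: v).map Int.natAbs : List ℕ) : Multiset ℕ) =
      (n + 1) ::ₘ (((u ++ v).map Int.natAbs : List ℕ) : Multiset ℕ) := by
    rw [List.map_append, List.map_cons, hc, List.map_append, Multiset.cons_coe, Multiset.coe_eq_coe]
    exact List.perm_middle
  rw [IsSignedPermutation, IsSignedPermutation, h, Icc_one_succ_val, Multiset.cons_inj_right]

theorem mem_signedPermutations_succ {n : ℕ} (w : List ℤ) :
    w ∈ signedPermutations (n + 1) ↔ ∃ c ∈ ({(n + 1 : ℤ), -(n + 1 : ℤ)} : Finset ℤ), ∃ u v,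
      u ++ v ∈ signedPermutations n ∧ w = u ++ c :: ([] ++ v) := by
  simp only [mem_signedPermutations, List.nil_append, Finset.mem_insert, Finset.mem_singleton]
  constructor
  · intro h
    have h1 : n + 1 ∈ ((w.map Int.natAbs : List ℕ) : Multiset ℕ) := by
      rw [show ((w.map Int.natAbs : List ℕ) : Multiset ℕ) = _ from h]
      simp
    obtain ⟨c, hc, hcn⟩ := List.mem_map.1 (Multiset.mem_coe.1 h1)
    obtain ⟨u, v, rfl⟩ := List.append_of_mem hc
    exact ⟨c, by omega, u, v, (isSignedPermutation_insert hcn).1 h, rfl⟩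
  · rintro ⟨c, hc, u, v, h, rfl⟩
    exact (isSignedPermutation_insert (by omega)).2 h

theorem B_zero : B 0 = 1 := by
  have h : signedPermutations 0 = {[]} := by
    ext w
    simp [mem_signedPermutations, IsSignedPermutation]
  simp [B, h, desB]

theorem B_succ (n : ℕ) :
    B (n + 1) = (1 + (2 * (n : ℤ[X]) + 1) * X) * B n + 2 * X * (1 - X) * derivative (B n) := by
  rw [B, sum_insertions mem_signedPermutations_succ]
  · rw [B, derivative_sum, Finset.mul_sum, Finset.mul_sum, ← Finset.sum_add_distrib]
    refine Finset.sum_congr rfl fun w hw => ?_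
    rw [mem_signedPermutations] at hw
    have hne : (n + 1 : ℤ) ≠ -(n + 1 : ℤ) := by omega
    simp only [Finset.sum_pair hne, desB_eq_descents, List.nil_append]
    rw [sum_descents_insert (n + 1) w
      (fun x hx => by have := hw.natAbs_le hx; omega) 0 (by omega), hw.length_eq, derivative_X_pow]
    generalize descents 0 w = d
    -- The derivative carries the truncated exponent d - 1.
    cases d with
    | zero => simp
    | succ d => simp; ring
  · intro w hw c hc hcw
    rw [mem_signedPermutations] at hw
    have := hw.natAbs_le hcw
    simp only [Finset.mem_insert, Finset.mem_singleton] at hc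
    omega

/-! ### Counting alternating runs recursively -/

/-- Given a last letter `a` that was reached by an ascent (`d = true`) or by a descent
(`d = false`), the number of changes of direction while the word `w` is appended. -/
def turns (d : Bool) (a : ℕ) : List ℕ → ℕ
  | [] => 0
  | b :: w => (if d = decide (a < b) then 0 else 1) + turns (decide (a < b)) b w

/-- The alternating runs are counted by their right end points. -/
theorem run_eq_card (w : List ℕ) (hw : w.IsChain (· ≠ ·)) :
    run w = ((Finset.range w.length).filter fun j => 1 ≤ j ∧ (j + 1 < w.length →
      ¬ (w.getD (j - 1) 0 < w.getD j 0 ↔ w.getD j 0 < w.getD (j + 1) 0))).card := by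
  classical
  have hne : ∀ k, k + 1 < w.length → w.getD k 0 ≠ w.getD (k + 1) 0 := by
    intro k hk
    have := List.isChain_iff_getElem.1 hw k hk
    simpa [List.getD_eq_getElem?_getD, List.getElem?_eq_getElem hk,
      List.getElem?_eq_getElem (show k < w.length by omega)] using this
  have hsub : ∀ i j i' j', i' ≤ i → i < j → j ≤ j' → IsMonotoneSegment w i' j' →
      IsMonotoneSegment w i j := by
    rintro i j i' j' h1 h2 h3 ⟨h4, h5, h6⟩
    refine ⟨h2, by omega, h6.imp ?_ ?_⟩ <;> exact fun h k hk hk' => h k (by omega) (by omega)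
  rw [run]
  refine Finset.card_nbij Prod.snd ?_ ?_ ?_
  · rintro ⟨i, j⟩ h
    simp only [Finset.mem_coe, Finset.mem_filter, Finset.mem_product, Finset.mem_range] at h ⊢
    obtain ⟨⟨-, hj⟩, ⟨h1, -, h3⟩, hmax⟩ := h
    refine ⟨hj, by omega, fun hj1 hiff => ?_⟩
    have := hmax i (j + 1) le_rfl (by omega) ⟨by omega, hj1, ?_⟩
    · omega
    have hjj : j - 1 + 1 = j := by omega
    refine h3.imp ?_ ?_
    · intro h k hk hk'
      rcases Nat.lt_succ_iff_lt_or_eq.1 hk' with h' | rfl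
      · exact h k hk h'
      · have := h (k - 1) (by omega) (by omega)
        rw [hjj] at this
        exact hiff.1 this
    · intro h k hk hk'
      rcases Nat.lt_succ_iff_lt_or_eq.1 hk' with h' | rfl
      · exact h k hk h'
      · have := h (k - 1) (by omega) (by omega)
        rw [hjj] at this
        have h2 := hne k hj1
        have h3 := mt hiff.2 (by omega)
        omega
  · rintro ⟨i, j⟩ h ⟨i', j'⟩ h' heq
    simp only [Finset.mem_coe, Finset.mem_filter, Finset.mem_product, Finset.mem_range] at h h'
    dsimp only at heq h h'
    subst heq
    rcases le_total i i' with hi | hi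
    · rw [(h'.2.2 i j hi le_rfl h.2.1).1]
    · rw [(h.2.2 i' j hi le_rfl h'.2.1).1]
  · intro j hj
    simp only [Finset.mem_coe, Finset.mem_filter, Finset.mem_range] at hj
    obtain ⟨hj, hj1, hturn⟩ := hj
    have hjj : j - 1 + 1 = j := by omega
    have hex : ∃ i, IsMonotoneSegment w i j := by
      refine ⟨j - 1, by omega, hj, ?_⟩
      have := hne (j - 1) (by omega)
      rcases lt_or_gt_of_ne this with h | h
      · left
        intro k hk hk'
        obtain rfl : k = j - 1 := by omega
        exact h
      · right
        intro k hk hk'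
        obtain rfl : k = j - 1 := by omega
        exact h
    have hseg := Nat.find_spec hex
    -- The least left end makes the segment maximal to the left; the turn at j stops it on the
    -- right.
    set i := Nat.find hex with hi
    refine ⟨(i, j), ?_, rfl⟩
    have hij : i < j := hseg.1
    simp only [Finset.mem_coe, Finset.mem_filter, Finset.mem_product, Finset.mem_range]
    refine ⟨⟨by omega, hj⟩, hseg, fun i' j' hi' hj' h' => ⟨?_, ?_⟩⟩
    · have := Nat.find_min' hex (hsub i' j i' j' le_rfl (by omega) hj' h')
      omega
    · by_contra hne'
      obtain ⟨-, h5, h6⟩ := h'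
      refine hturn (by omega) ?_
      rcases h6 with h6 | h6
      · have h7 := h6 (j - 1) (by omega) (by omega)
        have h8 := h6 j (by omega) (by omega)
        rw [hjj] at h7
        exact iff_of_true h7 h8
      · have h7 := h6 (j - 1) (by omega) (by omega)
        have h8 := h6 j (by omega) (by omega)
        rw [hjj] at h7
        exact iff_of_false (by omega) (by omega)

theorem run_nil : run [] = 0 := by
  simp [run]

theorem run_cons_cons (a b : ℕ) (w : List ℕ) (hw : (a :: b :: w).IsChain (· ≠ ·)) :
    run (a :: b :: w) = 1 + turns (decide (a < b)) b w := by
  rw [run_eq_card _ hw]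
  clear hw
  induction w generalizing a b with
  | nil =>
    rw [Finset.card_filter, List.length_cons, List.length_singleton, Finset.sum_range_succ,
      Finset.sum_range_one]
    simp [turns]
  | cons c w ih =>
    rw [turns, add_left_comm, ← ih b c, Finset.card_filter, Finset.card_filter, List.length_cons,
      Finset.sum_range_succ', List.length_cons, Finset.sum_range_succ', List.length_cons,
      Finset.sum_range_succ' _ (w.length + 1)]
    simp [add_comm (if a < b ↔ b < c then 0 else 1)]

/-- The word `a :: w`, where `a` is reached in direction `d`, ends with a descent. -/
def EndsDown (d : Bool) (a : ℕ) : List ℕ → Prop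
  | [] => d = false
  | b :: w => EndsDown (decide (a < b)) b w

/-- The word `w` starts with a letter larger than `a`. -/
def startsUp (a : ℕ) : List ℕ → Bool
  | [] => false
  | b :: _ => decide (a < b)

theorem startsUp_cons (a b : ℕ) (w : List ℕ) : startsUp a (b :: w) = decide (a < b) := rfl

theorem turns_false_add (a : ℕ) (w : List ℕ) (hw : EndsDown true a w) :
    turns false a w + 1 = turns true a w + if startsUp a w then 2 else 0 := by
  cases w with
  | nil => simp [EndsDown] at hw
  | cons b w =>
    by_cases h : a < b <;> simp [turns, startsUp, h] <;> omega

/-- The block turns a gap into up, down, down. The two gaps next to a peak keep the number of turns;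
every other gap adds two. As the word ends with a descent, peaks and valleys alternate down to a
last peak, so the gaps next to peaks are counted by `turns`, with one more when an ascent into a is
followed by an ascent. -/
theorem sum_turns_insert (M M' : ℕ) (hM : M' < M) (w : List ℕ) (hw : ∀ x ∈ w, x < M')
    (d : Bool) (a : ℕ) (ha : a < M') (hd : EndsDown d a w) :
    ∑ i ∈ Finset.range (w.length + 1), (X : ℤ[X]) ^ turns d a (w.take i ++ M :: M' :: w.drop i) =
      (((turns d a w : ℕ) : ℤ[X]) + if d && startsUp a w then 1 else 0) * X ^ turns d a w +
      ((w.length : ℤ[X]) + 1 - (((turns d a w : ℕ) : ℤ[X]) + if d && startsUp a w then 1 else 0)) *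
        X ^ (turns d a w + 2) := by
  have haM := ha.trans hM
  induction w generalizing a d with
  | nil =>
    obtain rfl : d = false := hd
    simp [turns, haM, not_lt.2 hM.le]
  | cons b w ih =>
    have hb := hw b (by simp)
    have hbM := hb.trans hM
    rw [List.length_cons, Finset.sum_range_succ']
    simp only [List.take_succ_cons, List.drop_succ_cons, List.cons_append, List.take_zero,
      List.drop_zero, List.nil_append, turns]
    simp only [pow_add, ← Finset.mul_sum]
    rw [EndsDown] at hd
    rw [ih (fun x hx => hw x (List.mem_cons_of_mem _ hx)) _ b hb hd hbM]
    simp only [haM, not_lt.2 hM.le, not_lt.2 hb.le, startsUp_cons]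
    by_cases hab : a < b
    · have h := turns_false_add b w (by simpa [hab] using hd)
      simp only [hab, decide_true, decide_false]
      rcases hs : startsUp b w <;> rw [hs] at h <;> simp at h
      · rw [← h]
        cases d <;> simp <;> ring
      · obtain h : turns false b w = turns true b w + 1 := by omega
        rw [h]
        cases d <;> simp <;> ring
    · simp only [hab, decide_false]
      cases d <;> simp <;> ring

/-- Both M to M' and M' to the next letter are descents, and later steps are unchanged. -/
theorem EndsDown.insert {M M' : ℕ} (hM : M' < M) (u v : List ℕ) (hv : ∀ x ∈ v, x < M')
    (d : Bool) (a : ℕ) (h : EndsDown d a (u ++ v)) : EndsDown d a (u ++ M :: M' :: v) := by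
  induction u generalizing a d with
  | nil =>
    cases v with
    | nil => simp [EndsDown, hM.le]
    | cons b v =>
      have hb : ¬ M' < b := by have := hv b (by simp); omega
      simp only [List.nil_append, EndsDown, hb, decide_false] at h ⊢
      cases v with
      | nil => rfl
      | cons c v => exact h
  | cons b u ih => exact ih _ _ h

/-! ### The recurrence for the alternating run polynomials -/

theorem perm_insert_pair {α : Type*} (a b : α) (u v : List α) :
    (u ++ a :: b :: v).Perm (a :: b :: (u ++ v)) :=
  List.perm_middle.trans (List.perm_middle.cons a)

theorem nodup_insert_pair {α : Type*} {a b : α} {u v : List α} (hab : a ≠ b)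
    (ha : a ∉ u ++ v) (hb : b ∉ u ++ v) (h : (u ++ v).Nodup) : (u ++ a :: b :: v).Nodup := by
  rw [(perm_insert_pair a b u v).nodup_iff, List.nodup_cons, List.nodup_cons, List.mem_cons]
  exact ⟨by tauto, hb, h⟩

/-- In front, the block adds a run if p starts up and extends the first run if p starts down; in the
latter case the second gap adds one run instead. This accounts for the single X ^ (run p + 1). The
remaining gaps follow `sum_turns_insert`. In `EndsDown false 0 p` the letter 0 is virtual: it has no
effect once p has two letters. -/
theorem sum_run_insert (M M' : ℕ) (hM : M' < M) (p : List ℕ) (hp : p.Nodup)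
    (hlt : ∀ x ∈ p, x < M') (hdown : EndsDown false 0 p) (hlen : p.length ≠ 1) :
    ∑ i ∈ Finset.range (p.length + 1), (X : ℤ[X]) ^ run (p.take i ++ M :: M' :: p.drop i) =
      (run p : ℤ[X]) * X ^ run p + X ^ (run p + 1) +
        ((p.length : ℤ[X]) - ((run p : ℕ) : ℤ[X])) * X ^ (run p + 2) := by
  have hchain : ∀ i, (p.take i ++ M :: M' :: p.drop i).IsChain (· ≠ ·) := fun i =>
    List.Pairwise.isChain (nodup_insert_pair hM.ne'
      (by rw [List.take_append_drop]; intro h; have := hlt _ h; omega)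
      (by rw [List.take_append_drop]; intro h; have := hlt _ h; omega)
      (by rwa [List.take_append_drop]))
  match p, hp, hlt, hdown, hlen, hchain with
  | [], _, _, _, _, hchain =>
    have := run_cons_cons M M' [] (by simpa using hchain 0)
    simp [this, turns, run_nil]
  | [a], _, _, _, hlen, _ => simp at hlen
  | a :: b :: w, hp, hlt, hdown, _, hchain =>
    have ha := hlt a (by simp)
    have hb := hlt b (by simp)
    have haM := ha.trans hM
    have hbM := hb.trans hM
    have h0 := run_cons_cons a b w (List.Pairwise.isChain hp)
    have h1 := run_cons_cons M M' (a :: b :: w) (by simpa using hchain 0)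
    have h2 := run_cons_cons a M (M' :: b :: w) (by simpa using hchain 1)
    have h3 : ∀ i, run (a :: b :: (w.take i ++ M :: M' :: w.drop i)) = _ := fun i =>
      run_cons_cons a b _ (by simpa using hchain (i + 2))
    rw [List.length_cons, List.length_cons, Finset.sum_range_succ', Finset.sum_range_succ']
    simp only [List.take_succ_cons, List.drop_succ_cons, List.cons_append, List.take_zero,
      List.drop_zero, List.nil_append, h0, h1, h2, h3]
    simp only [turns, haM, not_lt.2 hM.le, not_lt.2 hb.le, not_lt.2 ha.le]
    simp only [pow_add, ← Finset.mul_sum]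
    rw [sum_turns_insert M M' hM w (fun x hx => hlt x (by simp [hx])) _ b hb hdown]
    by_cases hab : a < b
    · have h := turns_false_add b w (by simpa [EndsDown, hab] using hdown)
      simp only [hab, decide_true, decide_false]
      rcases hs : startsUp b w <;> rw [hs] at h <;> simp at h
      · rw [← h]
        simp
        ring
      · obtain h : turns false b w = turns true b w + 1 := by omega
        rw [h]
        simp
        ring
    · simp only [hab, decide_false]
      simp
      ring

/-- The map `dualMap`, where the letters of `s` are considered as having occurred before. -/
def dualAfter (s : List ℕ) : List ℕ → List ℕ
  | [] => []
  | a :: w => (if a ∈ s then 2 * a - 1 else 2 * a) :: dualAfter (a :: s) w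

theorem mapIdx_eq_dualAfter (s w : List ℕ) :
    w.mapIdx (fun i a => if a ∈ s ∨ a ∈ w.take i then 2 * a - 1 else 2 * a) = dualAfter s w := by
  induction w generalizing s with
  | nil => rfl
  | cons b w ih =>
    rw [List.mapIdx_cons, dualAfter, ← ih (b :: s)]
    simp [or_assoc, or_left_comm]

theorem dualMap_eq_dualAfter (w : List ℕ) : dualMap w = dualAfter [] w := by
  simp [dualMap, ← mapIdx_eq_dualAfter]

theorem length_dualAfter (s w : List ℕ) : (dualAfter s w).length = w.length := by
  induction w generalizing s with
  | nil => rfl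
  | cons a w ih => simp [dualAfter, ih]

theorem length_dualMap (w : List ℕ) : (dualMap w).length = w.length := by
  simp [dualMap]

theorem dualAfter_congr {s s' w : List ℕ} (h : ∀ a ∈ w, a ∈ s ↔ a ∈ s') :
    dualAfter s w = dualAfter s' w := by
  induction w generalizing s s' with
  | nil => rfl
  | cons a w ih =>
    rw [dualAfter, dualAfter, ih (s := a :: s) (s' := a :: s'), if_congr (h a (by simp)) rfl rfl]
    intro b hb
    simp [h b (by simp [hb])]

theorem dualAfter_append (s u v : List ℕ) :
    dualAfter s (u ++ v) = dualAfter s u ++ dualAfter (u.reverse ++ s) v := by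
  induction u generalizing s with
  | nil => rfl
  | cons a u ih => simp [dualAfter, ih]

theorem dualMap_insert {N : ℕ} {u v : List ℕ} (hu : N ∉ u) (hv : N ∉ v) :
    dualMap (u ++ N :: N :: v) = (dualMap (u ++ v)).take u.length ++
      2 * N :: (2 * N - 1) :: (dualMap (u ++ v)).drop u.length := by
  rw [dualMap_eq_dualAfter, dualMap_eq_dualAfter, dualAfter_append, dualAfter_append,
    List.take_left' (length_dualAfter _ _), List.drop_left' (length_dualAfter _ _)]
  simp only [dualAfter, List.append_nil, List.mem_reverse, hu, if_false, List.mem_cons, true_or,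
    if_true]
  rw [dualAfter_congr (s := N :: N :: u.reverse) (s' := u.reverse)]
  intro a ha
  have : a ≠ N := by
    rintro rfl
    exact hv ha
  simp [this]

theorem dualMap_injective : Function.Injective dualMap := by
  -- Both 2a and 2a - 1 map back to a, also for a = 0 under truncated subtraction.
  refine Function.LeftInverse.injective (g := List.map fun x => (x + 1) / 2) fun w => ?_
  rw [dualMap_eq_dualAfter]
  generalize ([] : List ℕ) = s
  induction w generalizing s with
  | nil => rfl
  | cons a w ih =>
    rw [dualAfter, List.map_cons, ih]
    congr 1
    split_ifs <;> omega

theorem mem_stirlingPermutations {n : ℕ} {w : List ℕ} :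
    w ∈ stirlingPermutations n ↔
      (w : Multiset ℕ) = 2 • (Finset.Icc 1 n).val ∧ IsStirling w := by
  simp [stirlingPermutations, Multiset.mem_lists_iff, eq_comm]

theorem le_of_mem_stirlingPermutations {n : ℕ} {w : List ℕ} (hw : w ∈ stirlingPermutations n)
    {x : ℕ} (hx : x ∈ w) : x ≤ n := by
  have h : x ∈ (w : Multiset ℕ) := hx
  rw [(mem_stirlingPermutations.1 hw).1, Multiset.mem_nsmul] at h
  exact (Finset.mem_Icc.1 h.2).2

theorem length_of_mem_stirlingPermutations {n : ℕ} {w : List ℕ}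
    (hw : w ∈ stirlingPermutations n) : w.length = 2 * n := by
  simpa using congrArg Multiset.card (mem_stirlingPermutations.1 hw).1

theorem coe_insert_pair_eq_iff {n : ℕ} {u v : List ℕ} :
    ((u ++ (n + 1) :: (n + 1) :: v : List ℕ) : Multiset ℕ) = 2 • (Finset.Icc 1 (n + 1)).val ↔
      ((u ++ v : List ℕ) : Multiset ℕ) = 2 • (Finset.Icc 1 n).val := by
  rw [Multiset.coe_eq_coe.2 (perm_insert_pair _ _ u v), Icc_one_succ_val, two_nsmul, two_nsmul,
    Multiset.cons_add, Multiset.add_cons, ← Multiset.cons_coe, ← Multiset.cons_coe,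
    Multiset.cons_inj_right, Multiset.cons_inj_right]

theorem IsStirling.insert_pair {N : ℕ} {u v : List ℕ} (h : IsStirling (u ++ v))
    (hN : ∀ x ∈ u ++ v, x < N) : IsStirling (u ++ N :: N :: v) := by
  have hu : N ∉ u := fun hm => lt_irrefl _ (hN N (by simp [hm]))
  have hv : N ∉ v := fun hm => lt_irrefl _ (hN N (by simp [hm]))
  have hfilter : ∀ l : List ℕ, N ∉ l → l.filter (· ≠ N) = l := by
    intro l hl
    rw [List.filter_eq_self]
    intro a ha
    simp only [ne_eq, decide_eq_true_eq]
    rintro rfl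
    exact hl ha
  intro a b hab
  -- The two copies of N are adjacent, so N b N is no subsequence. For a ≠ N, deleting all N reduces
  -- to the old word.
  by_cases ha : a = N
  · subst ha
    exfalso
    clear h hN hfilter
    induction u with
    | nil => exact hv (List.singleton_sublist.1 hab.tail.tail)
    | cons x u ih =>
      rw [List.mem_cons, not_or] at hu
      rw [List.cons_append, List.cons_sublist_cons'] at hab
      exact ih hu.2 (hab.resolve_right fun h => hu.1 h.1)
  · have hmem : a ∈ u ++ v := by
      have := hab.subset (show a ∈ [a, b, a] by simp)
      simpa [ha] using this
    by_cases hb : b = N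
    · subst hb
      exact hN a hmem
    · have := hab.filter (· ≠ N)
      simp only [List.filter_append, hfilter u hu, List.filter_cons, hfilter v hv] at this
      simp [ha, hb] at this
      exact h a b this

theorem mem_stirlingPermutations_succ {n : ℕ} (w : List ℕ) :
    w ∈ stirlingPermutations (n + 1) ↔ ∃ c ∈ ({n + 1} : Finset ℕ), ∃ u v,
      u ++ v ∈ stirlingPermutations n ∧ w = u ++ c :: ([n + 1] ++ v) := by
  simp only [Finset.mem_singleton, exists_eq_left, List.singleton_append]
  constructor
  · intro h
    obtain ⟨h1, h2⟩ := mem_stirlingPermutations.1 h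
    have hmem : n + 1 ∈ w := by
      rw [← Multiset.mem_coe, h1]
      simp [Icc_one_succ_val]
    obtain ⟨u, v, rfl, hu⟩ := List.eq_append_cons_of_mem hmem
    have hcount : (u ++ (n + 1) :: v).count (n + 1) = 2 := by
      rw [← Multiset.coe_count, h1, Multiset.count_nsmul, Icc_one_succ_val, Multiset.count_cons_self,
        Multiset.count_eq_zero_of_notMem (by simp)]
    rw [List.count_append, List.count_cons_self, List.count_eq_zero_of_not_mem hu] at hcount
    have hv : n + 1 ∈ v := List.count_pos_iff.1 (by omega)
    cases v with
    | nil => simp at hv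
    | cons b v =>
      have hb : b = n + 1 := by
        by_contra hne
        have hv' : n + 1 ∈ v := by simpa [Ne.symm hne] using hv
        -- A letter between the two copies of n + 1 would have to exceed the maximum.
        have h3 := h2 (n + 1) b (List.Sublist.trans
          (((List.singleton_sublist.2 hv').cons_cons b).cons_cons (n + 1))
          (List.sublist_append_right u _))
        have h4 := le_of_mem_stirlingPermutations h (x := b) (by simp)
        omega
      subst hb
      refine ⟨u, v, mem_stirlingPermutations.2 ⟨coe_insert_pair_eq_iff.1 h1, fun a b hab => ?_⟩, rfl⟩
      refine h2 a b (hab.trans (List.Sublist.append_left ?_ u))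
      exact (List.sublist_cons_self _ _).trans (List.sublist_cons_self _ _)
  · rintro ⟨u, v, h, rfl⟩
    have hle : ∀ x ∈ u ++ v, x < n + 1 := fun x hx =>
      Nat.lt_succ_of_le (le_of_mem_stirlingPermutations h hx)
    obtain ⟨h1, h2⟩ := mem_stirlingPermutations.1 h
    exact mem_stirlingPermutations.2 ⟨coe_insert_pair_eq_iff.2 h1, h2.insert_pair hle⟩

theorem stirlingPermutations_zero : stirlingPermutations 0 = {[]} := by
  ext w
  rw [mem_stirlingPermutations]
  simp only [Finset.mem_singleton]
  constructor
  · rintro ⟨h, -⟩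
    simpa using h
  · rintro rfl
    exact ⟨by simp, fun a b h => by simp at h⟩

theorem F_eq_sum (n : ℕ) : F n = ∑ w ∈ stirlingPermutations n, X ^ run (dualMap w) := by
  rw [F, dualStirlingPermutations, Finset.sum_image dualMap_injective.injOn]

theorem F_zero : F 0 = 1 := by
  simp [F_eq_sum, stirlingPermutations_zero, dualMap, run_nil]

theorem dualMap_of_mem_stirlingPermutations {n : ℕ} {w : List ℕ}
    (hw : w ∈ stirlingPermutations n) :
    (dualMap w).Nodup ∧ (∀ x ∈ dualMap w, x ≤ 2 * n) ∧ EndsDown false 0 (dualMap w) := by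
  induction n generalizing w with
  | zero =>
    rw [stirlingPermutations_zero, Finset.mem_singleton] at hw
    subst hw
    simp [dualMap, EndsDown]
  | succ n ih =>
    obtain ⟨c, hc, u, v, huv, rfl⟩ := (mem_stirlingPermutations_succ w).1 hw
    rw [Finset.mem_singleton] at hc
    subst hc
    have hN : n + 1 ∉ u ++ v := fun h => by
      have := le_of_mem_stirlingPermutations huv h
      omega
    rw [List.mem_append, not_or] at hN
    rw [List.singleton_append, dualMap_insert hN.1 hN.2]
    obtain ⟨h1, h2, h3⟩ := ih huv
    generalize dualMap (u ++ v) = p at h1 h2 h3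
    rw [← List.take_append_drop u.length p] at h1 h2 h3
    refine ⟨nodup_insert_pair (by omega) ?_ ?_ h1, ?_, h3.insert (by omega) _ _ ?_ _ _⟩
    · intro h
      have := h2 _ h
      omega
    · intro h
      have := h2 _ h
      omega
    · intro x hx
      rw [(perm_insert_pair _ _ _ _).mem_iff, List.mem_cons, List.mem_cons] at hx
      rcases hx with rfl | rfl | hx
      · omega
      · omega
      · have := h2 _ hx
        omega
    · intro x hx
      have := h2 x (List.mem_append_right _ hx)
      omega

/-- A word with k runs and 2n letters contributes kx^k + x^(k+1) + (2n-k)x^(k+2); the factors k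
become a derivative. -/
theorem F_succ (n : ℕ) :
    F (n + 1) = (X + 2 * (n : ℤ[X]) * X ^ 2) * F n + X * (1 - X ^ 2) * derivative (F n) := by
  rw [F_eq_sum, sum_insertions mem_stirlingPermutations_succ]
  · rw [F_eq_sum, derivative_sum, Finset.mul_sum, Finset.mul_sum, ← Finset.sum_add_distrib]
    refine Finset.sum_congr rfl fun w hw => ?_
    obtain ⟨h1, h2, h3⟩ := dualMap_of_mem_stirlingPermutations hw
    have hlen := length_of_mem_stirlingPermutations hw
    have h4 := sum_run_insert (2 * (n + 1)) (2 * (n + 1) - 1) (by omega) (dualMap w) h1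
      (fun x hx => by have := h2 x hx; omega) h3 (by rw [length_dualMap]; omega)
    rw [length_dualMap, hlen] at h4
    have h5 : ∀ i ∈ Finset.range (w.length + 1), ∑ c ∈ ({n + 1} : Finset ℕ),
        (X : ℤ[X]) ^ run (dualMap (w.take i ++ c :: ([n + 1] ++ w.drop i))) =
        X ^ run ((dualMap w).take i ++ 2 * (n + 1) :: (2 * (n + 1) - 1) :: (dualMap w).drop i) := by
      intro i hi
      have hN : n + 1 ∉ w := fun h => by
        have := le_of_mem_stirlingPermutations hw h
        omega
      rw [Finset.mem_range] at hi
      rw [Finset.sum_singleton, List.singleton_append,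
        dualMap_insert (fun h => hN (List.mem_of_mem_take h)) (fun h => hN (List.mem_of_mem_drop h)),
        List.take_append_drop, List.length_take, min_eq_left (by omega)]
    rw [Finset.sum_congr rfl h5, hlen, h4, derivative_X_pow]
    generalize run (dualMap w) = k
    cases k with
    | zero => simp
    | succ k => simp; ring
  · intro w hw c hc hcw
    have := le_of_mem_stirlingPermutations hw hcw
    rw [Finset.mem_singleton] at hc
    omega

/-! ### The convolution identity and the determinant -/

theorem F_comp_neg_succ (n : ℕ) :
    (F (n + 1)).comp (-X) = (-X + 2 * (n : ℤ[X]) * X ^ 2) * (F n).comp (-X) +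
      X * (1 - X ^ 2) * derivative ((F n).comp (-X)) := by
  rw [F_succ, derivative_comp]
  simp

theorem X_mul_B_comp_succ (n : ℕ) :
    X * (B (n + 1)).comp (X ^ 2) = X * (1 - X ^ 2) * derivative (X * (B n).comp (X ^ 2)) +
      2 * ((n : ℤ[X]) + 1) * X ^ 2 * (X * (B n).comp (X ^ 2)) := by
  rw [B_succ, derivative_mul, derivative_comp]
  simp
  ring

theorem sum_choose_mul_F (n : ℕ) :
    ∑ k ∈ Finset.range (n + 1), (n.choose k : ℤ[X]) * ((F (n - k)).comp (-X) * F (k + 1)) =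
      X * (B n).comp (X ^ 2) := by
  induction n with
  | zero => simp [F_succ, F_zero, B_zero]
  | succ n ih =>
    rw [X_mul_B_comp_succ, ← ih,
      Finset.sum_choose_succ_mul (fun i j => (F j).comp (-X) * F (i + 1)) n, derivative_sum,
      Finset.mul_sum, Finset.mul_sum, ← Finset.sum_add_distrib, ← Finset.sum_add_distrib]
    refine Finset.sum_congr rfl fun k hk => ?_
    obtain ⟨m, rfl⟩ := Nat.exists_eq_add_of_le (Nat.lt_succ_iff.1 (Finset.mem_range.1 hk))
    -- The terms ±X cancel, and 2m + 2(k+1) = 2(n+1) matches the recurrence of the right side.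
    rw [show k + m + 1 - k = m + 1 by omega, show k + m - k = m by omega, F_comp_neg_succ m,
      F_succ (k + 1), derivative_mul, derivative_mul, derivative_natCast]
    push_cast
    ring

/-- The lower unitriangular matrix of the linear system satisfied by the polynomials `F`. -/
noncomputable def convMatrix (n : ℕ) : Matrix (Fin (n + 1)) (Fin (n + 1)) ℤ[X] :=
  Matrix.of fun i j =>
    if j ≤ i then (((i : ℕ).choose (j : ℕ) : ℕ) : ℤ[X]) * (F ((i : ℕ) - (j : ℕ))).comp (-X) else 0

theorem det_convMatrix (n : ℕ) : (convMatrix n).det = 1 := by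
  rw [Matrix.det_of_isLowerTriangular]
  · simp [convMatrix, F_zero]
  · intro i j hij
    have : ¬ j ≤ i := not_le.2 hij
    simp [convMatrix, this]

theorem convMatrix_mulVec (n : ℕ) :
    (convMatrix n).mulVec (fun k => F ((k : ℕ) + 1)) =
      fun i : Fin (n + 1) => X * (B (i : ℕ)).comp (X ^ 2) := by
  funext i
  rw [← sum_choose_mul_F, Matrix.mulVec, dotProduct]
  simp only [convMatrix, Matrix.of_apply, Fin.le_def]
  rw [Fin.sum_univ_eq_sum_range (fun k => (if k ≤ (i : ℕ) then
    (((i : ℕ).choose k : ℕ) : ℤ[X]) * (F ((i : ℕ) - k)).comp (-X) else 0) * F (k + 1)) (n + 1)]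
  symm
  refine Finset.sum_subset_zero_on_sdiff (Finset.range_mono i.2) ?_ ?_
  · intro k hk
    have : ¬ k ≤ (i : ℕ) := by
      simp only [Finset.mem_sdiff, Finset.mem_range] at hk
      omega
    simp [this]
  · intro k hk
    rw [if_pos (Nat.lt_succ_iff.1 (Finset.mem_range.1 hk))]
    ring

theorem det_hessenberg (n : ℕ) : (hessenberg n).det = F (n + 1) := by
  have hcramer : ((convMatrix n).updateCol (Fin.last n)
      fun i : Fin (n + 1) => X * (B (i : ℕ)).comp (X ^ 2)).det = F (n + 1) := by
    rw [← Matrix.cramer_apply, ← convMatrix_mulVec, Matrix.cramer_eq_adjugate_mulVec,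
      Matrix.mulVec_mulVec, Matrix.adjugate_mul, det_convMatrix]
    simp
  -- The Hessenberg matrix is Cramer's matrix with its last column moved to the front and the others
  -- negated. The n negations cancel the sign (-1)^n of the (n+1)-cycle.
  let s : Fin (n + 1) → ℤ[X] := fun j => if j = 0 then 1 else -1
  have hh : hessenberg n = Matrix.of fun i j => s j * ((convMatrix n).updateCol (Fin.last n)
      fun i : Fin (n + 1) => X * (B (i : ℕ)).comp (X ^ 2)).submatrix id (finRotate (n + 1)).symm i j := by
    ext i j : 1
    refine Fin.cases ?_ (fun j => ?_) j
    · have : (finRotate (n + 1)).symm 0 = Fin.last n := by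
        rw [Equiv.symm_apply_eq, finRotate_last]
      simp only [hessenberg, s, Matrix.of_apply, Matrix.submatrix_apply, this]
      simp
    · have : (finRotate (n + 1)).symm j.succ = j.castSucc := by
        rw [Equiv.symm_apply_eq, finRotate_apply, Fin.coeSucc_eq_succ]
      have hlt : (j : ℕ) < n := j.2
      simp only [hessenberg, s, Matrix.of_apply, Matrix.submatrix_apply, this, id_eq,
        Matrix.updateCol_ne (Fin.castSucc_lt_last j).ne, convMatrix, Fin.le_def]
      simp
  rw [hh, Matrix.det_mul_row, Matrix.det_permute', hcramer, Equiv.Perm.sign_symm, sign_finRotate]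
  simp only [s, Fin.prod_univ_succ]
  simp [← mul_assoc, ← mul_pow]

/-! ### The derivatives of `r` -/

theorem hasDerivAt_r {x : ℝ} (hx : x ∈ Set.Ioo (-1 : ℝ) 1) :
    HasDerivAt r (r x / (1 - x ^ 2)) x := by
  obtain ⟨h1, h2⟩ := hx
  have h1' : 0 < 1 + x := by linarith
  have h2' : 0 < 1 - x := by linarith
  have hpos : 0 < (1 + x) / (1 - x) := div_pos h1' h2'
  have h : HasDerivAt r _ x :=
    (((hasDerivAt_id x).const_add 1).fun_div ((hasDerivAt_id x).const_sub 1) h2'.ne').sqrt hpos.ne'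
  refine h.congr_deriv ?_
  have hs := Real.sq_sqrt hpos.le
  have hr : 0 < √((1 + x) / (1 - x)) := Real.sqrt_pos.2 hpos
  rw [eq_div_iff h2'.ne'] at hs
  have h3 : 1 - x ^ 2 ≠ 0 := by nlinarith
  simp only [r, id]
  rw [div_div, div_eq_div_iff (by positivity) h3]
  linear_combination (-(2 * (1 - x))) * hs

theorem xDeriv_iterate_r (n : ℕ) {x : ℝ} (hx : x ∈ Set.Ioo (-1 : ℝ) 1) :
    (xDeriv^[n]) r x = r x * aeval x (F n) / (1 - x ^ 2) ^ n := by
  induction n generalizing x with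
  | zero => simp [F_zero]
  | succ n ih =>
    have h3 : 1 - x ^ 2 ≠ 0 := by nlinarith [hx.1, hx.2]
    -- The formula is known only on the open interval, so it is differentiated as a germ at x.
    have heq : (xDeriv^[n]) r =ᶠ[nhds x] fun y => r y * aeval y (F n) / (1 - y ^ 2) ^ n :=
      Filter.eventually_of_mem (isOpen_Ioo.mem_nhds hx) fun y hy => ih hy
    have hd := ((hasDerivAt_r hx).mul ((F n).hasDerivAt_aeval x)).div
      ((((hasDerivAt_id x).pow 2).const_sub 1).pow n) (pow_ne_zero n h3)
    have hd' : deriv (fun y => r y * aeval y (F n) / (1 - y ^ 2) ^ n) x = _ := hd.deriv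
    rw [Function.iterate_succ_apply', xDeriv, heq.deriv_eq, hd', F_succ]
    simp only [map_add, map_mul, map_sub, map_pow, map_one, map_natCast, map_ofNat, aeval_X]
    cases n with
    | zero => simp; field_simp
    | succ n => simp; field_simp; ring

end DualStirling

theorem mainTheorem8 :
    (∀ (n : ℕ) (x : ℝ), x ∈ Set.Ioo (-1 : ℝ) 1 →
      (DualStirling.xDeriv^[n]) DualStirling.r x =
        DualStirling.r x * Polynomial.aeval x (DualStirling.F n) / (1 - x ^ 2) ^ n) ∧
    (∀ n : ℕ, 1 ≤ n → DualStirling.F (n + 1) = (DualStirling.hessenberg n).det) :=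
  ⟨fun n _ hx => DualStirling.xDeriv_iterate_r n hx, fun n _ => (DualStirling.det_hessenberg n).symm⟩
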